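/- Let $T>0$, let $0<\beta<2$ and let $f(x)=|x|^{-\beta}$ for $x\in\mathbb{R}^3\setminus\{0\}$. For a Schwartz function $\varphi$ on $\mathbb{R}^3$ put $\mathcal{F}\varphi(\xi)=\int_{\mathbb{R}^3}\varphi(x)e^{-i\xi\cdot x}\,dx$. A non-negative Borel measure $\mu$ on $\mathbb{R}^3$ is called tempered if $\int_{\mathbb{R}^3}(1+|\xi|^2)^{-m}\mu(d\xi)<\infty$ for some integer $m\ge 1$; a function $g$ is the Fourier transform of $\mu$ if $\int_{\mathbb{R}^3} g\varphi\,dx=\int_{\mathbb{R}^3}\mathcal{F}\varphi\,d\mu$ for all Schwartz functions $\varphi$ (the left side being absolutely convergent). Let $\sigma$ be the uniform surface measure, of total mass $4\pi$, on the unit sphere $S^2\subset\mathbb{R}^3$. Then the following hold. (i) $f$ is the Fourier transform of a non-negative tempered measure $\mu$ (its spectral measure), and for every $\gamma$ with $0<\gamma<\frac{2-\beta}{2}$ (so that $\gamma\le 1$) the measure $|\zeta|^{2\gamma}\mu(d\zeta)$ is tempered, its Fourier transform is a non-negative locally integrable function, and $$\int_{\mathbb{R}^3}\frac{\mu(d\zeta)}{1+|\zeta|^{2-2\gamma}}<\infty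 .$$ (ii) There is a constant $C$ such that $\int_{|z|\le h}\frac{f(z)}{|z|}\,dz\le C\,h^{2-\beta}$ for all $0<h\le 2T$. In particular, with $\nu=\min(2-\beta,1)\in(0,1]$ there is a constant $C$ such that $\int_{|z|\le h}\frac{f(z)}{|z|}\,dz\le C\,h^{\nu}$ for all $0<h\le 2T$. (iii) For every $\rho_1$ with $0<\rho_1<\min(2-\beta,1)$ there is a constant $C$ such that for all $0<h\le 1$ $$\int_0^T\int_{S^2}\int_{S^2}\bigl|f\bigl(s(\xi+\eta)+h(\xi+\eta)\bigr)-f\bigl(s(\xi+\eta)+h\eta\bigr)\bigr|\,s\,\sigma(d\xi)\,\sigma(d\eta)\,ds\le C\,h^{\rho_1}.$$ (iv) For every $\rho_2$ with $0<\rho_2<2-\beta$ (so that $\rho_2\le 2$) there is a constant $C$ such that for all $0<h\le 1$ $$\int_0^T\int_{S^2}\int_{S^2}\bigl|f\bigl(s(\xi+\eta)+h(\xi+\eta)\bigr)-f\bigl(s(\xi+\eta)+h\xi\bigr)-f\bigl(s(\xi+\eta)+h\eta\bigr)+f\bigl(s(\xi+\eta)\bigr)\bigr|\,s^2\,\sigma(d\xi)\,\sigma(d\eta)\,ds\le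 C\,h^{\rho_2}.$$ -/

import Mathlib

open MeasureTheory Set

noncomputable section

/-- Three dimensional Euclidean space. -/
abbrev E3 : Type := EuclideanSpace ℝ (Fin 3)

/-- The Riesz kernel `|x|^(-β)` on `ℝ³` (its value at the single point `0` is irrelevant). -/
def rieszKernel (β : ℝ) (x : E3) : ℝ := ‖x‖ ^ (-β)

/-- The Fourier transform `∫ φ(x) e^{-i ξ·x} dx` of a Schwartz function, in the normalization
without `2π` in the exponent. -/
def schwartzFourier (φ : SchwartzMap E3 ℂ) (ξ : E3) : ℂ :=
  ∫ x : E3, φ x * Complex.exp (-(Complex.I * ((inner ℝ ξ x : ℝ) : ℂ)))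

/-- A non-negative tempered measure: `(1 + |ξ|²)^(-m)` is integrable for some integer `m ≥ 1`. -/
def IsTemperedMeasure (μ : Measure E3) : Prop :=
  ∃ m : ℕ, 1 ≤ m ∧ Integrable (fun ξ : E3 => ((1 + ‖ξ‖ ^ 2) ^ m)⁻¹) μ

/-- `f` is a non-negative locally integrable function, which defines a tempered distribution, and
which is the Fourier transform, in the sense of tempered distributions, of the non-negative
tempered measure `μ`: `∫ f φ dx = ∫ ℱφ dμ` for all Schwartz functions `φ`.
In other words, `μ` is the spectral measure of `f`. -/
structure IsSpectralMeasure (f : E3 → ℝ) (μ : Measure E3) : Prop where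
  nonneg : ∀ x, 0 ≤ f x
  locallyIntegrable : LocallyIntegrable f
  integrable_mul : ∀ φ : SchwartzMap E3 ℂ, Integrable (fun x : E3 => (f x : ℂ) * φ x)
  tempered : IsTemperedMeasure μ
  integral_eq : ∀ φ : SchwartzMap E3 ℂ,
    ∫ x : E3, (f x : ℂ) * φ x = ∫ ξ : E3, schwartzFourier φ ξ ∂μ

/-- The measure `|ζ|^(2γ) μ(dζ)`. -/
def powWeighted (μ : Measure E3) (γ : ℝ) : Measure E3 :=
  μ.withDensity (fun ζ : E3 => ENNReal.ofReal (‖ζ‖ ^ (2 * γ)))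

/-- The spectral condition of order `γ` for the spectral measure `μ`: `0 < γ ≤ 1`, the measure
`|ζ|^(2γ) μ(dζ)` is tempered and its Fourier transform is a non-negative locally integrable
function, and `∫ μ(dζ) / (1 + |ζ|^(2 - 2γ)) < ∞`. -/
structure SpectralCondition (μ : Measure E3) (γ : ℝ) : Prop where
  pos : 0 < γ
  le_one : γ ≤ 1
  fourier_nonneg : ∃ g : E3 → ℝ, IsSpectralMeasure g (powWeighted μ γ)
  lintegral_lt_top :
    ∫⁻ ζ : E3, ENNReal.ofReal (1 / (1 + ‖ζ‖ ^ (2 - 2 * γ))) ∂μ < ⊤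

/-- The bound `∫_{|z| ≤ h} f(z)/|z| dz ≤ C h^ν` for all `0 < h ≤ 2T`. -/
def BallBound (f : E3 → ℝ) (T ν : ℝ) : Prop :=
  ∃ C : ℝ, ∀ h : ℝ, 0 < h → h ≤ 2 * T →
    ∫⁻ z in Metric.closedBall (0 : E3) h, ENNReal.ofReal (f z / ‖z‖)
      ≤ ENNReal.ofReal (C * h ^ ν)

/-- The uniform surface measure (of total mass `4π`) on the unit sphere `S²` of `ℝ³`. -/
def sphereMeasure : Measure (Metric.sphere (0 : E3) 1) :=
  (volume : Measure E3).toSphere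

/-- The first time increment condition, with exponent `ρ`. -/
def TimeCondition1 (f : E3 → ℝ) (T ρ : ℝ) : Prop :=
  0 < ρ ∧ ρ ≤ 1 ∧ ∃ C : ℝ, ∀ h : ℝ, 0 < h → h ≤ 1 →
    ∫⁻ s in Icc (0 : ℝ) T,
      ∫⁻ ξ : Metric.sphere (0 : E3) 1, ∫⁻ η : Metric.sphere (0 : E3) 1,
        ENNReal.ofReal
          (|f (s • ((ξ : E3) + (η : E3)) + h • ((ξ : E3) + (η : E3)))
            - f (s • ((ξ : E3) + (η : E3)) + h • (η : E3))| * s)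
        ∂sphereMeasure ∂sphereMeasure
      ≤ ENNReal.ofReal (C * h ^ ρ)

/-- The second time increment condition, with exponent `ρ`. -/
def TimeCondition2 (f : E3 → ℝ) (T ρ : ℝ) : Prop :=
  0 < ρ ∧ ρ ≤ 2 ∧ ∃ C : ℝ, ∀ h : ℝ, 0 < h → h ≤ 1 →
    ∫⁻ s in Icc (0 : ℝ) T,
      ∫⁻ ξ : Metric.sphere (0 : E3) 1, ∫⁻ η : Metric.sphere (0 : E3) 1,
        ENNReal.ofReal
          (|f (s • ((ξ : E3) + (η : E3)) + h • ((ξ : E3) + (η : E3)))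
            - f (s • ((ξ : E3) + (η : E3)) + h • (ξ : E3))
            - f (s • ((ξ : E3) + (η : E3)) + h • (η : E3))
            + f (s • ((ξ : E3) + (η : E3)))| * s ^ 2)
        ∂sphereMeasure ∂sphereMeasure
      ≤ ENNReal.ofReal (C * h ^ ρ)

end

/-! Spectral part. A Gaussian and its Fourier transform are paired with a Schwartz function
(`integral_gaussian_mul_schwartzFourier`), and the identity is integrated in the width `t` against
`t ^ ((3 - α) / 2 - 1)`. Both sides become Gamma integrals, which give `|x|^(-α)` against `φ` and
`|ξ|^(α - 3)` against its transform (`integral_rieszKernel_mul_eq`, `0 < α < 3`). The weight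
`|ζ|^(2γ)` only shifts `α = β` to `β + 2γ < 2`, so the weighted measure stays in the same family,
and the same inequality gives convergence at infinity in the last spectral integral.

The ball bound is scaling.

Time increments. With `r = |ξ + η|` one has `|aξ + bη|² = (a - b)² + a b r²`, so every point at
which the kernel is evaluated has norm at least `s r`. The differences are therefore bounded by `(s
r)^(-β)` and, when `h ≤ s r`, also by `(s r)^(-β) (h / (s r))^k`, with `k = 1` for the first
difference and `k = 2` for the mixed one. Interpolation (`le_mul_rpow_of_le_of_le`) yields `h^ρ (s
r)^(-β-ρ)`. As `β + ρ < 2`, this is integrable over the two-dimensional sphere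
(`exists_lintegral_sphere_norm_add_rpow_le`) and, with the weights `s` and `s²`, in time. -/

open scoped FourierTransform

/-! ### Radial powers on `ℝ³` and the ball bound. -/

theorem integrable_radial_of_le_rpow {F : ℝ → ℝ} (hF : Measurable F) {a b : ℝ}
    (ha : -3 < a) (hb : b < -3) (h0 : ∀ y, 0 < y → y ≤ 1 → |F y| ≤ y ^ a)
    (h1 : ∀ y, 1 < y → |F y| ≤ y ^ b) : Integrable (fun x : E3 => F ‖x‖) := by
  rw [integrable_fun_norm_addHaar]
  simp only [finrank_euclideanSpace, Fintype.card_fin, smul_eq_mul, Nat.add_one_sub_one]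
  have hm : Measurable fun y : ℝ => y ^ 2 * F y := by fun_prop
  rw [← Ioc_union_Ioi_eq_Ioi (zero_le_one (α := ℝ))]
  refine IntegrableOn.union ?_ ?_
  · have hi : IntegrableOn (fun y : ℝ => y ^ (2 + a)) (Ioc 0 1) := by
      rw [← intervalIntegrable_iff_integrableOn_Ioc_of_le zero_le_one]
      exact intervalIntegral.intervalIntegrable_rpow' (by linarith)
    refine Integrable.mono' hi hm.aestronglyMeasurable
      ((ae_restrict_mem measurableSet_Ioc).mono fun y hy => ?_)
    rw [Real.norm_eq_abs, abs_mul, abs_of_nonneg (by positivity), Real.rpow_add hy.1,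
      Real.rpow_two]
    gcongr
    exact h0 y hy.1 hy.2
  · have hi : IntegrableOn (fun y : ℝ => y ^ (2 + b)) (Ioi 1) :=
      integrableOn_Ioi_rpow_of_lt (by linarith) one_pos
    refine Integrable.mono' hi hm.aestronglyMeasurable
      ((ae_restrict_mem measurableSet_Ioi).mono fun y hy => ?_)
    rw [Real.norm_eq_abs, abs_mul, abs_of_nonneg (by positivity),
      Real.rpow_add (one_pos.trans hy), Real.rpow_two]
    gcongr
    exact h1 y hy

theorem integrableOn_ball_norm_rpow {a : ℝ} (ha : -3 < a) (r : ℝ) :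
    IntegrableOn (fun x : E3 => ‖x‖ ^ a) (Metric.ball 0 r) := by
  rw [integrableOn_fun_norm_addHaar (volume : Measure E3) (f := fun y : ℝ => y ^ a)]
  simp only [finrank_euclideanSpace, Fintype.card_fin, smul_eq_mul, Nat.add_one_sub_one]
  have hi : IntegrableOn (fun y : ℝ => y ^ (2 + a)) (Ioo 0 r) := by
    rcases le_total r 0 with hr | hr
    · simp [Ioo_eq_empty_of_le hr]
    · refine IntegrableOn.mono_set ?_ Ioo_subset_Ioc_self
      rw [← intervalIntegrable_iff_integrableOn_Ioc_of_le hr]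
      exact intervalIntegral.intervalIntegrable_rpow' (by linarith)
  refine hi.congr_fun (fun y hy => ?_) measurableSet_Ioo
  simp only [Real.rpow_add hy.1, Real.rpow_two]

theorem locallyIntegrable_norm_rpow {a : ℝ} (ha : -3 < a) :
    LocallyIntegrable (fun x : E3 => ‖x‖ ^ a) := by
  intro x
  refine ⟨Metric.ball 0 (‖x‖ + 1), Metric.isOpen_ball.mem_nhds (by simp), ?_⟩
  exact integrableOn_ball_norm_rpow ha _

theorem integrable_norm_rpow_mul_inv {a : ℝ} (ha : -3 < a) (ha' : a < 1) :
    Integrable (fun x : E3 => ‖x‖ ^ a * ((1 + ‖x‖ ^ 2) ^ 2)⁻¹) := by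
  refine integrable_radial_of_le_rpow (F := fun y => y ^ a * ((1 + y ^ 2) ^ 2)⁻¹)
    (a := a) (b := a - 4) (by fun_prop) ha (by linarith) ?_ ?_
  · intro y hy _
    rw [abs_of_nonneg (by positivity)]
    refine mul_le_of_le_one_right (by positivity) (inv_le_one_of_one_le₀ ?_)
    nlinarith [sq_nonneg y, sq_nonneg (y ^ 2)]
  · intro y hy
    have hy0 : 0 < y := by linarith
    rw [abs_of_nonneg (by positivity), sub_eq_add_neg, Real.rpow_add hy0, Real.rpow_neg hy0.le]
    have : y ^ (4 : ℝ) = y ^ 4 := by norm_cast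
    rw [this]
    gcongr
    nlinarith [sq_nonneg y]

theorem setLIntegral_closedBall_norm_rpow {a : ℝ} (ha : -3 < a) {h : ℝ} (hh : 0 < h) :
    ∫⁻ z in Metric.closedBall (0 : E3) h, ENNReal.ofReal (‖z‖ ^ a) =
      ENNReal.ofReal ((∫ z in Metric.closedBall (0 : E3) 1, ‖z‖ ^ a) * h ^ (3 + a)) := by
  have hint : IntegrableOn (fun x : E3 => ‖x‖ ^ a) (Metric.closedBall 0 h) :=
    (integrableOn_ball_norm_rpow ha (h + 1)).mono_set
      (Metric.closedBall_subset_ball (by linarith))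
  rw [← ofReal_integral_eq_lintegral_ofReal hint (ae_of_all _ fun x => by positivity)]
  congr 1
  have := Measure.setIntegral_comp_smul_of_pos (volume : Measure E3)
    (fun x : E3 => ‖x‖ ^ a) (Metric.closedBall 0 1) hh
  rw [smul_closedBall _ _ zero_le_one] at this
  simp only [smul_zero, mul_one, Real.norm_eq_abs, abs_of_pos hh, norm_smul,
    finrank_euclideanSpace, Fintype.card_fin, smul_eq_mul,
    Real.mul_rpow hh.le (norm_nonneg _), integral_const_mul] at this
  rw [Real.rpow_add hh, ← mul_assoc, mul_right_comm, mul_comm _ (h ^ a), this]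
  have h3 : h ^ (3 : ℝ) = h ^ 3 := by norm_cast
  rw [h3]
  field_simp

theorem rieszKernel_div_norm (β : ℝ) (hβ : 0 < β) (z : E3) :
    rieszKernel β z / ‖z‖ = ‖z‖ ^ (-β - 1) := by
  rcases eq_or_ne z 0 with rfl | hz
  · rw [norm_zero, div_zero, Real.zero_rpow (by linarith)]
  · rw [rieszKernel, Real.rpow_sub_one (norm_ne_zero_iff.2 hz)]

theorem ballBound_rieszKernel {β : ℝ} (hβ0 : 0 < β) (hβ2 : β < 2) (T : ℝ) :
    BallBound (rieszKernel β) T (2 - β) := by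
  refine ⟨∫ z in Metric.closedBall (0 : E3) 1, ‖z‖ ^ (-β - 1), fun h hh _ => ?_⟩
  simp only [rieszKernel_div_norm β hβ0]
  rw [setLIntegral_closedBall_norm_rpow (by linarith) hh]
  ring_nf
  rfl

theorem BallBound.mono_exponent {f : E3 → ℝ} {T ν ν' : ℝ} (hf : BallBound f T ν)
    (hν : ν' ≤ ν) : BallBound f T ν' := by
  obtain ⟨C, hC⟩ := hf
  -- The surplus power `h ^ (ν - ν')` is at most `(2T) ^ (ν - ν')`; `max C 0` is there because `C`
  -- may be negative.
  refine ⟨max C 0 * (2 * T) ^ (ν - ν'), fun h hh hT => (hC h hh hT).trans ?_⟩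
  apply ENNReal.ofReal_le_ofReal
  calc C * h ^ ν ≤ max C 0 * h ^ ν := by gcongr; exact le_max_left _ _
    _ = max C 0 * h ^ (ν - ν') * h ^ ν' := by rw [mul_assoc, ← Real.rpow_add hh]; ring_nf
    _ ≤ _ := by gcongr

/-! ### Singular integrals over the sphere. -/

/-- The cone over a point lies in a line, which is Lebesgue null. This allows the antipodal point `η
= -ξ`, where the pointwise bounds fail, to be discarded. -/
theorem sphereMeasure_singleton (η : Metric.sphere (0 : E3) 1) : sphereMeasure {η} = 0 := by
  rw [sphereMeasure, Measure.toSphere_apply' _ (measurableSet_singleton _)]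
  refine mul_eq_zero_of_right _ (measure_mono_null (t := (Submodule.span ℝ {(η : E3)} : Set E3)) ?_
    (Measure.addHaar_submodule _ _ ?_))
  · rintro _ ⟨r, -, _, ⟨_, rfl, rfl⟩, rfl⟩
    exact Submodule.smul_mem _ _ (Submodule.mem_span_singleton_self _)
  · intro h
    have h1 := finrank_span_singleton (K := ℝ) (v := (η : E3)) (ne_zero_of_mem_unit_sphere η)
    rw [h, finrank_top] at h1
    simp at h1

theorem ae_add_ne_zero (ξ : Metric.sphere (0 : E3) 1) :
    ∀ᵐ η : Metric.sphere (0 : E3) 1 ∂sphereMeasure, (ξ : E3) + η ≠ 0 := by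
  refine measure_mono_null (t := {-ξ}) (fun η hη => ?_) (sphereMeasure_singleton _)
  simp only [ne_eq, mem_compl_iff, mem_ofPred_eq, not_not] at hη
  exact Subtype.ext (eq_neg_of_add_eq_zero_right hη)

theorem ofReal_le_volumeIoiPow_two_Ioo (δ : ℝ) :
    ENNReal.ofReal δ ≤ Measure.volumeIoiPow 2 {r : Ioi (0 : ℝ) | 1 < r.1 ∧ r.1 < 1 + δ} := by
  rw [Measure.volumeIoiPow, withDensity_apply _ (by measurability)]
  have hs : MeasurableSet {r : Ioi (0 : ℝ) | 1 < r.1 ∧ r.1 < 1 + δ} := by measurability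
  have hsub : (Subtype.val '' {r : Ioi (0 : ℝ) | 1 < r.1 ∧ r.1 < 1 + δ}) = Ioo 1 (1 + δ) := by
    ext x
    simp only [mem_image, mem_ofPred_eq, Subtype.exists, mem_Ioi, mem_Ioo]
    exact ⟨by rintro ⟨y, _, h, rfl⟩; exact h, fun h => ⟨x, by linarith [h.1], h, rfl⟩⟩
  calc ENNReal.ofReal δ
      = (Measure.comap Subtype.val volume) {r : Ioi (0 : ℝ) | 1 < r.1 ∧ r.1 < 1 + δ} := by
        rw [comap_subtype_coe_apply measurableSet_Ioi, hsub, Real.volume_Ioo]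
        ring_nf
    _ = ∫⁻ r in {r : Ioi (0 : ℝ) | 1 < r.1 ∧ r.1 < 1 + δ}, 1 ∂(Measure.comap Subtype.val volume) := by
        rw [setLIntegral_one]
    _ ≤ _ := by
        refine setLIntegral_mono' hs fun r hr => ?_
        rw [ENNReal.one_le_ofReal]
        exact one_le_pow₀ hr.1.le

/-- The sphere is thickened radially. With `δ = |ξ + η|` and `1 < r < 1 + δ` one has `|ξ + rη| ≤
2δ`, and this interval has length `δ`, so `δ^(-q)` is at most `2^(q+1)` times the radial integral of
`|ξ + rη|^(-q-1)`. Polar coordinates turn the sum over `η` into an integral of `|x|^(-q-1)` over a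
ball of `ℝ³`, finite for `q < 2`; translation invariance makes it independent of `ξ`. -/
theorem exists_lintegral_sphere_norm_add_rpow_le {q : ℝ} (hq0 : 0 < q) (hq : q < 2) :
    ∃ K : ENNReal, K ≠ ⊤ ∧ ∀ ξ : Metric.sphere (0 : E3) 1,
      ∫⁻ η : Metric.sphere (0 : E3) 1, ENNReal.ofReal (‖(ξ : E3) + η‖ ^ (-q)) ∂sphereMeasure
        ≤ K := by
  set G : E3 → ENNReal :=
    -- Any radius above `4` would do, since `|ξ + rη| < 2δ ≤ 4`.
    (Metric.ball (0 : E3) 5).indicator fun x => ENNReal.ofReal (‖x‖ ^ (-q - 1)) with hG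
  have hGm : Measurable G := by
    refine Measurable.indicator ?_ measurableSet_ball
    fun_prop
  have hGfin : ∫⁻ x, G x ≠ ⊤ := by
    rw [hG, lintegral_indicator measurableSet_ball]
    exact (integrableOn_ball_norm_rpow (by linarith) 5).lintegral_lt_top.ne
  refine ⟨ENNReal.ofReal (2 ^ (q + 1)) * ∫⁻ x, G x,
    ENNReal.mul_ne_top ENNReal.ofReal_ne_top hGfin, fun ξ => ?_⟩
  have key : ∀ η : Metric.sphere (0 : E3) 1, ENNReal.ofReal (‖(ξ : E3) + η‖ ^ (-q)) ≤
      ENNReal.ofReal (2 ^ (q + 1)) *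
        ∫⁻ r : Ioi (0 : ℝ), G ((ξ : E3) + r.1 • (η : E3)) ∂(Measure.volumeIoiPow 2) := by
    intro η
    set δ := ‖(ξ : E3) + η‖ 
    have hδ2 : δ ≤ 2 := (norm_add_le _ _).trans (by simp; norm_num)
    rcases (norm_nonneg ((ξ : E3) + η)).eq_or_lt with h0 | h0
    · change 0 = δ at h0
      rw [← h0, Real.zero_rpow (by linarith)]
      simp
    change 0 < δ at h0
    set S := {r : Ioi (0 : ℝ) | 1 < r.1 ∧ r.1 < 1 + δ}
    have hSm : MeasurableSet S := by measurability
    calc ENNReal.ofReal (δ ^ (-q))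
        = ENNReal.ofReal (2 ^ (q + 1)) * (ENNReal.ofReal ((2 * δ) ^ (-q - 1)) *
            ENNReal.ofReal δ) := by
          rw [← ENNReal.ofReal_mul (by positivity), ← ENNReal.ofReal_mul (by positivity)]
          congr 1
          rw [Real.mul_rpow (by norm_num) h0.le, Real.rpow_sub_one h0.ne',
            show -q - 1 = -(q + 1) by ring, Real.rpow_neg (by norm_num : (0 : ℝ) ≤ 2)]
          have : (2 : ℝ) ^ (q + 1) ≠ 0 := by positivity
          field_simp
      _ ≤ ENNReal.ofReal (2 ^ (q + 1)) * (ENNReal.ofReal ((2 * δ) ^ (-q - 1)) *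
            Measure.volumeIoiPow 2 S) := by
          gcongr
          exact ofReal_le_volumeIoiPow_two_Ioo δ
      _ = ENNReal.ofReal (2 ^ (q + 1)) * ∫⁻ r in S, ENNReal.ofReal ((2 * δ) ^ (-q - 1))
            ∂(Measure.volumeIoiPow 2) := by rw [setLIntegral_const]
      _ ≤ ENNReal.ofReal (2 ^ (q + 1)) * ∫⁻ r in S, G ((ξ : E3) + r.1 • (η : E3))
            ∂(Measure.volumeIoiPow 2) := by
          gcongr 1
          refine setLIntegral_mono' hSm fun r hr => ?_
          have hle : ‖(ξ : E3) + r.1 • (η : E3)‖ ≤ δ + (r.1 - 1) := by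
            calc ‖(ξ : E3) + r.1 • (η : E3)‖
                = ‖((ξ : E3) + η) + (r.1 - 1) • (η : E3)‖ := by congr 1; module
              _ ≤ _ := by
                refine (norm_add_le _ _).trans ?_
                rw [norm_smul, norm_eq_of_mem_sphere, mul_one, Real.norm_eq_abs,
                  abs_of_pos (by linarith [hr.1])]
          have hpos : 0 < ‖(ξ : E3) + r.1 • (η : E3)‖ := by
            have := norm_sub_norm_le (r.1 • (η : E3)) (-(ξ : E3))
            rw [norm_smul, norm_eq_of_mem_sphere, norm_neg, norm_eq_of_mem_sphere, mul_one,
              Real.norm_eq_abs, abs_of_pos r.2, sub_neg_eq_add, add_comm (r.1 • (η : E3))] at this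
            linarith [hr.1]
          rw [hG, indicator_of_mem (by
            rw [mem_ball_zero_iff]; linarith [hr.2])]
          apply ENNReal.ofReal_le_ofReal
          exact Real.rpow_le_rpow_of_nonpos hpos (by linarith [hr.2]) (by linarith)
      _ ≤ _ := by
          gcongr 1
          exact setLIntegral_le_lintegral _ _
  calc _ ≤ ∫⁻ η : Metric.sphere (0 : E3) 1, ENNReal.ofReal (2 ^ (q + 1)) *
        ∫⁻ r : Ioi (0 : ℝ), G ((ξ : E3) + r.1 • (η : E3)) ∂(Measure.volumeIoiPow 2)
          ∂sphereMeasure := lintegral_mono key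
    _ = ENNReal.ofReal (2 ^ (q + 1)) * ∫⁻ η : Metric.sphere (0 : E3) 1,
        ∫⁻ r : Ioi (0 : ℝ), G ((ξ : E3) + r.1 • (η : E3)) ∂(Measure.volumeIoiPow 2)
          ∂sphereMeasure := lintegral_const_mul' _ _ ENNReal.ofReal_ne_top
    _ ≤ _ := by
      gcongr 1
      rw [← lintegral_prod (f := fun p : Metric.sphere (0 : E3) 1 × Ioi (0 : ℝ) =>
        G ((ξ : E3) + p.2.1 • (p.1 : E3))) (hGm.comp (by fun_prop)).aemeasurable]
      have hmp := (volume : Measure E3).measurePreserving_homeomorphUnitSphereProd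
      simp only [finrank_euclideanSpace, Fintype.card_fin, Nat.add_one_sub_one] at hmp
      rw [sphereMeasure, ← hmp.lintegral_comp_emb (Homeomorph.measurableEmbedding _)]
      have : ∀ a : ({0}ᶜ : Set E3), (homeomorphUnitSphereProd E3 a).2.1 •
          ((homeomorphUnitSphereProd E3 a).1 : E3) = a := by
        intro a
        simp [smul_smul, norm_ne_zero_iff.2 a.2]
      simp only [this]
      rw [lintegral_subtype_comap (measurableSet_singleton _).compl (fun x => G ((ξ : E3) + x))]
      refine (setLIntegral_le_lintegral _ _).trans ?_
      rw [lintegral_add_left_eq_self]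

/-! ### Pointwise bounds for first and mixed differences. -/

theorem abs_rpow_neg_sub_le {p m x y : ℝ} (hp : 0 < p) (hm : 0 < m) (hx : m ≤ x) (hy : m ≤ y) :
    |x ^ (-p) - y ^ (-p)| ≤ p * m ^ (-p - 1) * |x - y| := by
  have := (convex_Ici m).norm_image_sub_le_of_norm_hasDerivWithin_le
    (f := fun z : ℝ => z ^ (-p)) (f' := fun z => -p * z ^ (-p - 1)) (C := p * m ^ (-p - 1))
    (fun z hz => (Real.hasDerivAt_rpow_const
      (Or.inl (hm.trans_le hz).ne')).hasDerivWithinAt) (fun z hz => ?_) hy hx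
  · simpa only [Real.norm_eq_abs] using this
  · have hz0 : 0 < z := hm.trans_le hz
    rw [Real.norm_eq_abs, abs_mul, abs_neg, abs_of_pos hp, abs_of_nonneg (by positivity)]
    exact mul_le_mul_of_nonneg_left
      (Real.rpow_le_rpow_of_nonpos hm hz (by linarith)) hp.le

/-- As a function of the half-step `t ∈ [0, d]` the symmetric difference vanishes at `0`, and its
derivative is itself a first difference, of exponent `-p - 1` and step `2t`. -/
theorem abs_rpow_neg_add_sub_two_mul_le {p m M d : ℝ} (hp : 0 < p) (hm : 0 < m) (hd : 0 ≤ d)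
    (h : m ≤ M - d) :
    |(M + d) ^ (-p) + (M - d) ^ (-p) - 2 * M ^ (-p)| ≤
      2 * (p * (p + 1)) * m ^ (-p - 2) * d ^ 2 := by
  have := (convex_Icc 0 d).norm_image_sub_le_of_norm_hasDerivWithin_le
    (f := fun t : ℝ => (M + t) ^ (-p) + (M - t) ^ (-p) - 2 * M ^ (-p))
    (f' := fun t => -p * ((M + t) ^ (-p - 1) - (M - t) ^ (-p - 1)))
    (C := p * ((p + 1) * m ^ (-p - 2) * (2 * d)))
    (fun t ht => ?_) (fun t ht => ?_) (left_mem_Icc.2 hd) (right_mem_Icc.2 hd)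
  · simp only [add_zero, sub_zero, Real.norm_eq_abs, abs_of_nonneg hd] at this
    rw [show M ^ (-p) + M ^ (-p) - 2 * M ^ (-p) = 0 by ring, sub_zero] at this
    exact this.trans_eq (by ring)
  · have h1 : HasDerivAt (fun t : ℝ => (M + t) ^ (-p)) (1 * -p * (M + t) ^ (-p - 1)) t :=
      ((hasDerivAt_id t).const_add M).rpow_const (Or.inl (by simp; linarith [ht.1]))
    have h2 : HasDerivAt (fun t : ℝ => (M - t) ^ (-p)) (-1 * -p * (M - t) ^ (-p - 1)) t :=
      ((hasDerivAt_id t).const_sub M).rpow_const (Or.inl (by simp; linarith [ht.2]))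
    exact (((h1.add h2).sub_const (2 * M ^ (-p))).hasDerivWithinAt).congr_deriv (by ring)
  · have h1 := abs_rpow_neg_sub_le (p := p + 1) (x := M + t) (y := M - t) (by linarith) hm
      (by linarith [ht.1]) (by linarith [ht.2])
    rw [Real.norm_eq_abs, abs_mul, abs_neg, abs_of_pos hp]
    rw [show -(p + 1) = -p - 1 by ring, show -p - 1 - 1 = -p - 2 by ring] at h1
    gcongr
    refine h1.trans ?_
    gcongr
    rw [abs_le]; constructor <;> linarith [ht.1, ht.2]

theorem le_mul_rpow_of_le_of_le {D c β k ρ h m : ℝ} (hc : 0 ≤ c) (hm : 0 < m) (hh : 0 < h)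
    (hρ0 : 0 ≤ ρ) (hρ : ρ ≤ k) (h0 : D ≤ c * m ^ (-β))
    (h1 : h ≤ m → D ≤ c * m ^ (-β) * (h / m) ^ k) : D ≤ c * h ^ ρ * m ^ (-β - ρ) := by
  have e : c * h ^ ρ * m ^ (-β - ρ) = c * m ^ (-β) * (h / m) ^ ρ := by
    rw [Real.div_rpow hh.le hm.le, Real.rpow_sub hm]
    ring
  rw [e]
  rcases le_total h m with hle | hle
  · refine (h1 hle).trans ?_
    gcongr 1
    exact Real.rpow_le_rpow_of_exponent_ge (by positivity) ((div_le_one hm).2 hle) hρ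
  · refine h0.trans (le_mul_of_one_le_right (by positivity) ?_)
    exact Real.one_le_rpow ((one_le_div hm).2 hle) hρ0

/-- Because the kernel is radial, the mean value theorem is applied to the norms only; the segment
from `x` to `y` may pass through the origin. -/
theorem abs_rieszKernel_sub_le {β ρ h m : ℝ} (hβ : 0 < β) (hρ0 : 0 ≤ ρ) (hρ : ρ ≤ 1)
    (hm : 0 < m) (hh : 0 < h) {x y : E3} (hx : m ≤ ‖x‖) (hy : m ≤ ‖y‖) (hxy : ‖x - y‖ ≤ h) :
    |rieszKernel β x - rieszKernel β y| ≤ (1 + β) * h ^ ρ * m ^ (-β - ρ) := by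
  refine le_mul_rpow_of_le_of_le (k := 1) (by positivity) hm hh hρ0 hρ ?_ fun _ => ?_
  · have h1 : ‖x‖ ^ (-β) ≤ m ^ (-β) := Real.rpow_le_rpow_of_nonpos hm hx (by linarith)
    have h2 : ‖y‖ ^ (-β) ≤ m ^ (-β) := Real.rpow_le_rpow_of_nonpos hm hy (by linarith)
    have h3 : 0 ≤ ‖x‖ ^ (-β) := by positivity
    have h4 : 0 ≤ ‖y‖ ^ (-β) := by positivity
    have h5 : 0 ≤ β * m ^ (-β) := by positivity
    rw [rieszKernel, rieszKernel, abs_le]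
    constructor <;> linarith
  · calc |rieszKernel β x - rieszKernel β y|
        ≤ β * m ^ (-β - 1) * |‖x‖ - ‖y‖| := abs_rpow_neg_sub_le hβ hm hx hy
      _ ≤ β * m ^ (-β - 1) * h := by
        gcongr
        exact (abs_norm_sub_norm_le x y).trans hxy
      _ = β * (m ^ (-β) * (h / m)) := by rw [Real.rpow_sub_one hm.ne']; ring
      _ ≤ (1 + β) * (m ^ (-β) * (h / m)) := by gcongr; linarith
      _ = _ := by rw [Real.rpow_one]; ring

theorem rieszKernel_eq_sq_rpow (β : ℝ) (x : E3) :
    rieszKernel β x = (‖x‖ ^ 2) ^ (-(β / 2)) := by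
  rw [rieszKernel, ← Real.rpow_natCast_mul (norm_nonneg _)]
  congr 1
  push_cast
  ring

theorem norm_smul_add_smul_sq (ξ η : Metric.sphere (0 : E3) 1) (a b : ℝ) :
    ‖a • (ξ : E3) + b • (η : E3)‖ ^ 2 = (a - b) ^ 2 + a * b * ‖(ξ : E3) + η‖ ^ 2 := by
  rw [norm_add_sq_real, norm_add_sq_real, norm_smul, norm_smul, norm_eq_of_mem_sphere,
    norm_eq_of_mem_sphere, real_inner_smul_left, real_inner_smul_right, mul_one, mul_one,
    Real.norm_eq_abs, Real.norm_eq_abs, sq_abs, sq_abs]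
  ring

/-- The mixed difference splits into a symmetric second difference about the midpoint of `A` and
`B`, plus twice a first difference between that midpoint and `E`. The two smallness hypotheses make
both pieces of size `m^(-p-1) e`. -/
theorem abs_rpow_neg_mixed_diff_le {p A B E m e : ℝ} (hp : 0 < p) (hm : 0 < m) (hA : B ≤ A)
    (hB : m ≤ B) (hE : m ≤ E) (hAB : ((A - B) / 2) ^ 2 ≤ 16 * m * e)
    (hABE : |(A + B) / 2 - E| ≤ e) :
    |A ^ (-p) - E ^ (-p) - E ^ (-p) + B ^ (-p)| ≤
      (32 * p * (p + 1) + 2 * p) * (m ^ (-p - 1) * e) := by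
  set M := (A + B) / 2 with hM
  set d := (A - B) / 2 with hd
  have hd0 : 0 ≤ d := by rw [hd]; linarith
  have hMd : M - d = B := by rw [hM, hd]; ring
  have hMd' : M + d = A := by rw [hM, hd]; ring
  have h1 := abs_rpow_neg_add_sub_two_mul_le (p := p) (m := m) (M := M) (d := d) hp hm hd0
    (by rw [hMd]; exact hB)
  have h2 := abs_rpow_neg_sub_le (p := p) (m := m) (x := M) (y := E) hp hm
    (by linarith) hE
  rw [hMd, hMd'] at h1
  have e1 : m ^ (-p - 2) * m = m ^ (-p - 1) := by
    rw [← Real.rpow_add_one hm.ne']; congr 1; ring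
  have h3 : A ^ (-p) - E ^ (-p) - E ^ (-p) + B ^ (-p) =
      (A ^ (-p) + B ^ (-p) - 2 * M ^ (-p)) + 2 * (M ^ (-p) - E ^ (-p)) := by ring
  rw [h3]
  calc _ ≤ |A ^ (-p) + B ^ (-p) - 2 * M ^ (-p)| + |2 * (M ^ (-p) - E ^ (-p))| :=
        abs_add_le _ _
    _ ≤ 2 * (p * (p + 1)) * m ^ (-p - 2) * d ^ 2 + 2 * (p * m ^ (-p - 1) * |M - E|) := by
        rw [abs_mul, abs_two]; gcongr
    _ ≤ 2 * (p * (p + 1)) * m ^ (-p - 2) * (16 * m * e) +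
          2 * (p * m ^ (-p - 1) * e) := by gcongr
    _ = 32 * p * (p + 1) * ((m ^ (-p - 2) * m) * e) + 2 * p * (m ^ (-p - 1) * e) := by ring
    _ = _ := by rw [e1]; ring

theorem sq_half_sub_le {s h r : ℝ} (hs : 0 < s) (hh : 0 < h) (hr0 : 0 < r) (hr2 : r ≤ 2)
    (hle : h ≤ s * r) :
    (((s + h) ^ 2 * r ^ 2 - (s * r) ^ 2) / 2) ^ 2 ≤ 16 * (s * r) ^ 2 * h ^ 2 := by
  have hs2 : h ≤ 2 * s := by
    calc h ≤ s * r := hle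
      _ ≤ s * 2 := by gcongr
      _ = 2 * s := by ring
  have e : ((s + h) ^ 2 * r ^ 2 - (s * r) ^ 2) / 2 = r * (r * h * (2 * s + h) / 2) := by ring
  rw [e]
  calc (r * (r * h * (2 * s + h) / 2)) ^ 2 ≤ (2 * (r * h * (2 * s + 2 * s) / 2)) ^ 2 := by gcongr
    _ = _ := by ring

/-- In terms of squared norms the two middle points coincide: both give `E`. The midpoint of the
outer values `A`, `B` differs from `E` by `h² (r² / 2 - 1)`, which is already of second order in
`h`. -/
theorem abs_rieszKernel_mixed_diff_le {β ρ h s : ℝ} (hβ : 0 < β) (hρ0 : 0 ≤ ρ) (hρ : ρ ≤ 2)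
    (hs : 0 < s) (hh : 0 < h) (ξ η : Metric.sphere (0 : E3) 1) (hξη : (ξ : E3) + η ≠ 0) :
    |rieszKernel β (s • ((ξ : E3) + (η : E3)) + h • ((ξ : E3) + (η : E3)))
      - rieszKernel β (s • ((ξ : E3) + (η : E3)) + h • (ξ : E3))
      - rieszKernel β (s • ((ξ : E3) + (η : E3)) + h • (η : E3))
      + rieszKernel β (s • ((ξ : E3) + (η : E3)))| ≤
      (4 + (16 * β * (β / 2 + 1) + β)) * h ^ ρ * (s * ‖(ξ : E3) + η‖) ^ (-β - ρ) := by
  set r := ‖(ξ : E3) + η‖ with hr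
  have hr0 : 0 < r := norm_pos_iff.2 hξη
  have hr2 : r ≤ 2 := (norm_add_le _ _).trans (by simp; norm_num)
  clear_value r
  simp only [rieszKernel_eq_sq_rpow]
  rw [show s • ((ξ : E3) + (η : E3)) + h • ((ξ : E3) + (η : E3))
      = (s + h) • (ξ : E3) + (s + h) • (η : E3) by module,
    show s • ((ξ : E3) + (η : E3)) + h • (ξ : E3) = (s + h) • (ξ : E3) + s • (η : E3) by module,
    show s • ((ξ : E3) + (η : E3)) + h • (η : E3) = s • (ξ : E3) + (s + h) • (η : E3) by module,
    show s • ((ξ : E3) + (η : E3)) = s • (ξ : E3) + s • (η : E3) by module]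
  simp only [norm_smul_add_smul_sq, ← hr]
  set p := β / 2 with hp
  have hp0 : 0 < p := by positivity
  set m := (s * r) ^ 2 with hm
  have hm0 : 0 < m := by positivity
  set A := (s + h - (s + h)) ^ 2 + (s + h) * (s + h) * r ^ 2 with hA
  set B := (s - s) ^ 2 + s * s * r ^ 2 with hB
  set E := (s + h - s) ^ 2 + (s + h) * s * r ^ 2 with hE
  have hE' : (s - (s + h)) ^ 2 + s * (s + h) * r ^ 2 = E := by rw [hE]; ring
  rw [hE']
  have hmA : m ≤ A := by
    have : A = m + (2 * s * h + h ^ 2) * r ^ 2 := by rw [hA, hm]; ring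
    rw [this]; exact le_add_of_nonneg_right (by positivity)
  have hmB : m = B := by rw [hB, hm]; ring
  have hmE : m ≤ E := by
    have : E = m + (h ^ 2 + h * s * r ^ 2) := by rw [hE, hm]; ring
    rw [this]; exact le_add_of_nonneg_right (by positivity)
  have hsr : m ^ (-p) = (s * r) ^ (-β) := by
    rw [hm, ← Real.rpow_natCast_mul (by positivity)]
    congr 1
    rw [hp]; push_cast; ring
  refine le_mul_rpow_of_le_of_le (k := 2) (by positivity) (by positivity) hh hρ0 hρ ?_
    fun hle => ?_
  · rw [← hsr, ← hmB]
    have h1 : A ^ (-p) ≤ m ^ (-p) := Real.rpow_le_rpow_of_nonpos hm0 hmA (by linarith)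
    have h2 : E ^ (-p) ≤ m ^ (-p) := Real.rpow_le_rpow_of_nonpos hm0 hmE (by linarith)
    have h3 : 0 ≤ A ^ (-p) := Real.rpow_nonneg (hm0.le.trans hmA) _
    have h4 : 0 ≤ E ^ (-p) := Real.rpow_nonneg (hm0.le.trans hmE) _
    have h5 : 0 ≤ (16 * β * (p + 1) + β) * m ^ (-p) := by positivity
    rw [abs_le]
    constructor <;> linarith
  · have e2 : m ^ (-p - 1) * h ^ 2 = (s * r) ^ (-β) * (h / (s * r)) ^ (2 : ℝ) := by
      rw [Real.rpow_sub_one hm0.ne', hsr, Real.rpow_two, hm]; ring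
    have hAB : ((A - B) / 2) ^ 2 ≤ 16 * m * h ^ 2 := by
      refine le_of_eq_of_le ?_ (sq_half_sub_le hs hh hr0 hr2 hle)
      rw [hA, hB]; ring
    have hABE : |(A + B) / 2 - E| ≤ h ^ 2 := by
      have e : (A + B) / 2 - E = h ^ 2 * (r ^ 2 / 2 - 1) := by rw [hA, hB, hE]; ring
      rw [e, abs_mul, abs_of_nonneg (by positivity : 0 ≤ h ^ 2)]
      refine mul_le_of_le_one_right (by positivity) ?_
      have hr4 : r ^ 2 ≤ 2 ^ 2 := by gcongr
      rw [abs_le]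
      constructor <;> linarith [sq_nonneg r]
    calc _ ≤ (32 * p * (p + 1) + 2 * p) * (m ^ (-p - 1) * h ^ 2) :=
          abs_rpow_neg_mixed_diff_le hp0 hm0 (hmB ▸ hmA) hmB.le hmE hAB hABE
      _ = (16 * β * (p + 1) + β) * (m ^ (-p - 1) * h ^ 2) := by rw [hp]; ring
      _ ≤ (4 + (16 * β * (p + 1) + β)) * (m ^ (-p - 1) * h ^ 2) :=
          mul_le_mul_of_nonneg_right (by linarith) (by positivity)
      _ = _ := by rw [e2]; ring

/-! ### Integration over time and spheres. -/

/-- The constant is chosen before `F` and `c`, so that `c` can carry the factor `h ^ ρ`. -/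
theorem exists_lintegral_time_sphere_le {q a : ℝ} (hq0 : 0 < q) (hq : q < 2) (ha : -1 < a - q)
    {T : ℝ} (hT : 0 < T) :
    ∃ C : ℝ, 0 ≤ C ∧
      ∀ (F : ℝ → Metric.sphere (0 : E3) 1 → Metric.sphere (0 : E3) 1 → ℝ) (c : ℝ), 0 ≤ c →
      (∀ s, 0 < s → ∀ ξ η : Metric.sphere (0 : E3) 1, (ξ : E3) + η ≠ 0 →
        F s ξ η ≤ c * (s * ‖(ξ : E3) + η‖) ^ (-q) * s ^ a) →
      ∫⁻ s in Icc (0 : ℝ) T,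
        ∫⁻ ξ : Metric.sphere (0 : E3) 1, ∫⁻ η : Metric.sphere (0 : E3) 1,
          ENNReal.ofReal (F s ξ η) ∂sphereMeasure ∂sphereMeasure ≤ ENNReal.ofReal (C * c) := by
  obtain ⟨K, hK, hKle⟩ := exists_lintegral_sphere_norm_add_rpow_le hq0 hq
  have hI : ∫⁻ s in Ioc (0 : ℝ) T, ENNReal.ofReal (s ^ (a - q)) ≠ ⊤ := by
    have : IntegrableOn (fun s : ℝ => s ^ (a - q)) (Ioc 0 T) := by
      rw [← intervalIntegrable_iff_integrableOn_Ioc_of_le hT.le]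
      exact intervalIntegral.intervalIntegrable_rpow' ha
    exact this.lintegral_lt_top.ne
  have hσ : sphereMeasure univ ≠ ⊤ := by
    rw [sphereMeasure]
    exact measure_ne_top _ _
  set I := ∫⁻ s in Ioc (0 : ℝ) T, ENNReal.ofReal (s ^ (a - q))
  have hfin : I * (K * sphereMeasure univ) ≠ ⊤ :=
    ENNReal.mul_ne_top hI (ENNReal.mul_ne_top hK hσ)
  refine ⟨(I * (K * sphereMeasure univ)).toReal, ENNReal.toReal_nonneg, fun F c hc hF => ?_⟩
  rw [ENNReal.ofReal_mul ENNReal.toReal_nonneg, ENNReal.ofReal_toReal hfin,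
    ← setLIntegral_congr (Ioc_ae_eq_Icc (a := (0 : ℝ)) (b := T))]
  calc _ ≤ ∫⁻ s in Ioc (0 : ℝ) T, ENNReal.ofReal (s ^ (a - q)) *
        (ENNReal.ofReal c * (K * sphereMeasure univ)) := by
        refine setLIntegral_mono' measurableSet_Ioc fun s hs => ?_
        have hin : ∀ ξ : Metric.sphere (0 : E3) 1,
            ∫⁻ η : Metric.sphere (0 : E3) 1, ENNReal.ofReal (F s ξ η) ∂sphereMeasure ≤
              ENNReal.ofReal (s ^ (a - q)) * ENNReal.ofReal c * K := by
          intro ξ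
          calc _ ≤ ∫⁻ η : Metric.sphere (0 : E3) 1,
                ENNReal.ofReal (s ^ (a - q)) * ENNReal.ofReal c *
                  ENNReal.ofReal (‖(ξ : E3) + η‖ ^ (-q)) ∂sphereMeasure := by
                refine lintegral_mono_ae ((ae_add_ne_zero ξ).mono fun η hη => ?_)
                have hs0 : 0 < s := hs.1
                rw [← ENNReal.ofReal_mul (by positivity), ← ENNReal.ofReal_mul (by positivity)]
                refine ENNReal.ofReal_le_ofReal ((hF s hs.1 ξ η hη).trans_eq ?_)
                rw [Real.mul_rpow hs0.le (norm_nonneg _), sub_eq_add_neg, Real.rpow_add hs0]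
                ring
            _ = _ := lintegral_const_mul' _ _
                (ENNReal.mul_ne_top ENNReal.ofReal_ne_top ENNReal.ofReal_ne_top)
            _ ≤ _ := by gcongr; exact hKle ξ
        calc _ ≤ ∫⁻ _ : Metric.sphere (0 : E3) 1,
              ENNReal.ofReal (s ^ (a - q)) * ENNReal.ofReal c * K ∂sphereMeasure :=
              lintegral_mono hin
          _ = _ := by rw [lintegral_const]; ring
    _ = I * (ENNReal.ofReal c * (K * sphereMeasure univ)) :=
        lintegral_mul_const' _ _ (ENNReal.mul_ne_top ENNReal.ofReal_ne_top
          (ENNReal.mul_ne_top hK hσ))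
    _ = _ := by ring

theorem timeCondition1_rieszKernel {β T ρ : ℝ} (hβ0 : 0 < β) (hT : 0 < T) (hρ0 : 0 < ρ)
    (hρ : ρ < 2 - β) (hρ1 : ρ ≤ 1) : TimeCondition1 (rieszKernel β) T ρ := by
  obtain ⟨C, -, hC⟩ := exists_lintegral_time_sphere_le (q := β + ρ) (a := 1)
    (by linarith) (by linarith) (by linarith) hT
  refine ⟨hρ0, hρ1, C * (1 + β), fun h hh _ => ?_⟩
  rw [mul_assoc]
  refine hC _ _ (by positivity) fun s hs ξ η hξη => ?_
  rw [Real.rpow_one]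
  have hr0 : 0 < ‖(ξ : E3) + η‖ := norm_pos_iff.2 hξη
  gcongr
  rw [neg_add']
  refine abs_rieszKernel_sub_le hβ0 hρ0.le hρ1 (by positivity) hh ?_ ?_ ?_
  · rw [← add_smul, norm_smul, Real.norm_of_nonneg (by positivity)]
    gcongr
    linarith
  · rw [← sq_le_sq₀ (by positivity) (by positivity),
      show s • ((ξ : E3) + (η : E3)) + h • (η : E3) = s • (ξ : E3) + (s + h) • (η : E3) by module,
      norm_smul_add_smul_sq]
    have : 0 ≤ h ^ 2 + s * h * ‖(ξ : E3) + η‖ ^ 2 := by positivity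
    linarith
  · rw [show s • ((ξ : E3) + (η : E3)) + h • ((ξ : E3) + (η : E3)) -
      (s • ((ξ : E3) + (η : E3)) + h • (η : E3)) = h • (ξ : E3) by module, norm_smul,
      norm_eq_of_mem_sphere, mul_one, Real.norm_of_nonneg hh.le]

theorem timeCondition2_rieszKernel {β T ρ : ℝ} (hβ0 : 0 < β) (hT : 0 < T) (hρ0 : 0 < ρ)
    (hρ : ρ < 2 - β) : TimeCondition2 (rieszKernel β) T ρ := by
  obtain ⟨C, -, hC⟩ := exists_lintegral_time_sphere_le (q := β + ρ) (a := 2)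
    (by linarith) (by linarith) (by linarith) hT
  refine ⟨hρ0, by linarith, C * (4 + (16 * β * (β / 2 + 1) + β)), fun h hh _ => ?_⟩
  rw [mul_assoc]
  refine hC _ _ (by positivity) fun s hs ξ η hξη => ?_
  rw [Real.rpow_two]
  gcongr
  rw [neg_add']
  exact abs_rieszKernel_mixed_diff_le hβ0 hρ0.le (by linarith) hs hh ξ η hξη

/-! ### Fourier transform of Riesz kernels by Gaussian superposition. -/

theorem schwartzFourier_eq (φ : SchwartzMap E3 ℂ) (ξ : E3) :
    schwartzFourier φ ξ = (𝓕 φ : SchwartzMap E3 ℂ) ((2 * Real.pi)⁻¹ • ξ) := by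
  rw [SchwartzMap.fourier_coe, Real.fourier_eq', schwartzFourier]
  refine integral_congr_ae (ae_of_all _ fun x => ?_)
  simp only [smul_eq_mul]
  rw [mul_comm, real_inner_smul_right, real_inner_comm]
  congr 2
  push_cast
  have : (Real.pi : ℂ) ≠ 0 := by exact_mod_cast Real.pi_ne_zero
  field_simp

theorem SchwartzMap.exists_norm_le_inv_sq (φ : SchwartzMap E3 ℂ) :
    ∃ C : ℝ, 0 ≤ C ∧ ∀ x, ‖φ x‖ ≤ C * ((1 + ‖x‖ ^ 2) ^ 2)⁻¹ := by
  obtain ⟨C, hC, h⟩ := φ.decay 0 0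
  obtain ⟨C', hC', h'⟩ := φ.decay 4 0
  refine ⟨2 * (C + C'), by positivity, fun x => ?_⟩
  have h1 := h x
  have h2 := h' x
  simp only [pow_zero, one_mul, norm_iteratedFDeriv_zero] at h1 h2
  rw [← div_eq_mul_inv, le_div_iff₀ (by positivity)]
  calc ‖φ x‖ * (1 + ‖x‖ ^ 2) ^ 2 ≤ ‖φ x‖ * (2 * (1 + ‖x‖ ^ 4)) := by
        gcongr
        nlinarith [sq_nonneg (1 - ‖x‖ ^ 2)]
    _ = 2 * (‖φ x‖ + ‖x‖ ^ 4 * ‖φ x‖) := by ring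
    _ ≤ _ := by gcongr

theorem exists_norm_schwartzFourier_le (φ : SchwartzMap E3 ℂ) :
    ∃ C : ℝ, 0 ≤ C ∧ ∀ ξ, ‖schwartzFourier φ ξ‖ ≤ C * ((1 + ‖ξ‖ ^ 2) ^ 2)⁻¹ := by
  obtain ⟨C, hC, h⟩ := (𝓕 φ : SchwartzMap E3 ℂ).exists_norm_le_inv_sq
  refine ⟨C * ((2 * Real.pi) ^ 2) ^ 2, by positivity, fun ξ => ?_⟩
  rw [schwartzFourier_eq]
  refine (h _).trans ?_
  rw [mul_assoc, ← div_eq_mul_inv (((2 * Real.pi) ^ 2) ^ 2), ← inv_div, ← div_pow]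
  gcongr
  rw [norm_smul, Real.norm_of_nonneg (by positivity), mul_pow (2 * Real.pi)⁻¹, inv_pow, add_div,
    div_eq_inv_mul (‖ξ‖ ^ 2)]
  gcongr
  rw [div_le_one (by positivity)]
  exact one_le_pow₀ (by linarith [Real.pi_gt_three])

theorem continuous_schwartzFourier (φ : SchwartzMap E3 ℂ) : Continuous (schwartzFourier φ) := by
  have : schwartzFourier φ = fun ξ => (𝓕 φ : SchwartzMap E3 ℂ) ((2 * Real.pi)⁻¹ • ξ) :=
    funext (schwartzFourier_eq φ)
  rw [this]
  exact (SchwartzMap.continuous _).comp (by fun_prop)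

theorem integrable_norm_rpow_mul {ψ : E3 → ℂ} (hψ : Continuous ψ) {C : ℝ}
    (hC : ∀ x, ‖ψ x‖ ≤ C * ((1 + ‖x‖ ^ 2) ^ 2)⁻¹) {a : ℝ} (ha : -3 < a) (ha' : a < 1) :
    Integrable (fun x : E3 => ((‖x‖ ^ a : ℝ) : ℂ) * ψ x) := by
  refine ((integrable_norm_rpow_mul_inv ha ha').const_mul C).mono' ?_ (ae_of_all _ fun x => ?_)
  · refine Measurable.aestronglyMeasurable ?_
    have := hψ.measurable
    fun_prop
  · rw [norm_mul, Complex.norm_real, Real.norm_of_nonneg (by positivity)]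
    calc _ ≤ ‖x‖ ^ a * (C * ((1 + ‖x‖ ^ 2) ^ 2)⁻¹) := by gcongr; exact hC x
      _ = _ := by ring

theorem integral_gaussian_mul_schwartzFourier (φ : SchwartzMap E3 ℂ) {t : ℝ} (ht : 0 < t) :
    ∫ ξ : E3, ((Real.exp (-(t * ‖ξ‖ ^ 2)) : ℝ) : ℂ) * schwartzFourier φ ξ =
      ∫ x : E3, (((Real.pi / t) ^ (3 / 2 : ℝ) * Real.exp (-(‖x‖ ^ 2 / 4 * t⁻¹)) : ℝ) : ℂ) * φ x := by
  have htre : 0 < (t : ℂ).re := by simpa using ht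
  have hg : Integrable (fun ξ : E3 => ((Real.exp (-(t * ‖ξ‖ ^ 2)) : ℝ) : ℂ)) := by
    have := GaussianFourier.integrable_cexp_neg_mul_sq_norm_add htre 0 (0 : E3)
    refine this.congr (ae_of_all _ fun ξ => ?_)
    simp
  have hprod : Integrable (Function.uncurry fun ξ x : E3 =>
      ((Real.exp (-(t * ‖ξ‖ ^ 2)) : ℝ) : ℂ) *
        (φ x * Complex.exp (-(Complex.I * ((inner ℝ ξ x : ℝ) : ℂ)))))
      ((volume : Measure E3).prod volume) := by
    refine (hg.mul_prod φ.integrable).mono ?_ (ae_of_all _ fun p => ?_)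
    · have := φ.continuous
      refine Continuous.aestronglyMeasurable ?_
      unfold Function.uncurry
      fun_prop
    · simp only [Function.uncurry, norm_mul]
      have : ‖Complex.exp (-(Complex.I * ((inner ℝ p.1 p.2 : ℝ) : ℂ)))‖ = 1 := by
        rw [Complex.norm_exp]; simp
      rw [this, mul_one]
  calc _ = ∫ ξ : E3, ∫ x : E3, ((Real.exp (-(t * ‖ξ‖ ^ 2)) : ℝ) : ℂ) *
        (φ x * Complex.exp (-(Complex.I * ((inner ℝ ξ x : ℝ) : ℂ)))) := by
        simp only [integral_const_mul]
        rfl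
    _ = ∫ x : E3, ∫ ξ : E3, ((Real.exp (-(t * ‖ξ‖ ^ 2)) : ℝ) : ℂ) *
        (φ x * Complex.exp (-(Complex.I * ((inner ℝ ξ x : ℝ) : ℂ)))) :=
        integral_integral_swap hprod
    _ = _ := by
      refine integral_congr_ae (ae_of_all _ fun x => ?_)
      have h := GaussianFourier.integral_cexp_neg_mul_sq_norm_add htre (-Complex.I) x
      calc _ = ∫ ξ : E3, φ x * Complex.exp (-(t : ℂ) * ‖ξ‖ ^ 2 +
            -Complex.I * ((inner ℝ x ξ : ℝ) : ℂ)) := by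
            refine integral_congr_ae (ae_of_all _ fun ξ => ?_)
            simp only
            rw [Complex.exp_add, real_inner_comm]
            push_cast
            ring_nf
        _ = _ := by
            rw [integral_const_mul, h, mul_comm]
            congr 1
            rw [Complex.ofReal_mul, Complex.ofReal_cpow (by positivity), Complex.ofReal_exp]
            simp only [finrank_euclideanSpace, Fintype.card_fin]
            congr 1
            · push_cast; rfl
            · congr 1
              push_cast
              rw [neg_sq, Complex.I_sq]
              field_simp

/-- Fubini for a superposition of kernels. Nonnegativity of `k` makes the `t`-integral of the
absolute value equal to `K |x|^a |ψ x|`, so absolute convergence is exactly `hint`. It serves both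
sides of the Gaussian identity. -/
theorem integral_Ioi_integral_kernel_mul {k : ℝ → E3 → ℝ} (hk : Measurable (Function.uncurry k))
    (hk0 : ∀ t, 0 < t → ∀ x, 0 ≤ k t x) {K a : ℝ}
    (hki : ∀ x ≠ 0, IntegrableOn (fun t => k t x) (Ioi 0))
    (hK : ∀ x ≠ 0, ∫ t in Ioi 0, k t x = K * ‖x‖ ^ a) {ψ : E3 → ℂ} (hψ : Continuous ψ)
    (hint : Integrable (fun x : E3 => ((‖x‖ ^ a : ℝ) : ℂ) * ψ x)) :
    ∫ t in Ioi (0 : ℝ), ∫ x : E3, (k t x : ℂ) * ψ x =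
      K * ∫ x : E3, ((‖x‖ ^ a : ℝ) : ℂ) * ψ x := by
  have hne : ∀ᵐ x : E3, x ≠ 0 := Measure.ae_ne volume 0
  have hprod : Integrable (Function.uncurry fun (t : ℝ) (x : E3) => (k t x : ℂ) * ψ x)
      ((volume.restrict (Ioi (0 : ℝ))).prod volume) := by
    rw [integrable_prod_iff']
    · constructor
      · filter_upwards [hne] with x hx
        exact ((hki x hx).ofReal (𝕜 := ℂ)).mul_const (ψ x)
      · refine (hint.norm.const_mul K).congr ?_
        filter_upwards [hne] with x hx
        have : ∀ t ∈ Ioi (0 : ℝ), ‖Function.uncurry (fun (t : ℝ) (x : E3) => (k t x : ℂ) * ψ x)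
            (t, x)‖ = k t x * ‖ψ x‖ := fun t ht => by
          simp only [Function.uncurry, norm_mul, Complex.norm_real,
            Real.norm_of_nonneg (hk0 t ht x)]
        rw [setIntegral_congr_fun measurableSet_Ioi this, integral_mul_const, hK x hx, norm_mul,
          Complex.norm_real, Real.norm_of_nonneg (by positivity), mul_assoc]
    · refine Measurable.aestronglyMeasurable ?_
      exact (Complex.measurable_ofReal.comp hk).mul (hψ.measurable.comp measurable_snd)
  rw [integral_integral_swap hprod, ← integral_const_mul]
  refine integral_congr_ae ?_
  filter_upwards [hne] with x hx
  rw [integral_mul_const, integral_complex_ofReal, hK x hx]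
  push_cast
  ring

theorem integrableOn_Ioi_rpow_mul_exp_neg {a r : ℝ} (ha : 0 < a) (hr : 0 < r) :
    IntegrableOn (fun t : ℝ => t ^ (a - 1) * Real.exp (-(r * t))) (Ioi 0) := by
  have := integrableOn_rpow_mul_exp_neg_mul_rpow (s := a - 1) (p := 1) (b := r)
    (by linarith) one_pos hr
  simpa only [Real.rpow_one, neg_mul] using this

/-- The substitution `u = 1/t`, Jacobian included, which reduces the integral with `t⁻¹` in the
exponent to a Gamma integral. -/
theorem rpow_neg_one_sub_mul_exp_eq (a r : ℝ) {t : ℝ} (ht : 0 < t) :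
    t ^ (-a - 1) * Real.exp (-(r * t⁻¹)) =
      (|(-1 : ℝ)| * t ^ ((-1 : ℝ) - 1)) •
        (fun u : ℝ => u ^ (a - 1) * Real.exp (-(r * u))) (t ^ (-1 : ℝ)) := by
  simp only [abs_neg, abs_one, one_mul, smul_eq_mul]
  rw [← Real.rpow_mul ht.le, ← mul_assoc, ← Real.rpow_add ht, Real.rpow_neg_one]
  congr 2
  ring

theorem integrableOn_Ioi_rpow_mul_exp_neg_inv {a r : ℝ} (ha : 0 < a) (hr : 0 < r) :
    IntegrableOn (fun t : ℝ => t ^ (-a - 1) * Real.exp (-(r * t⁻¹))) (Ioi 0) := by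
  refine IntegrableOn.congr_fun ((integrableOn_Ioi_comp_rpow_iff _ (p := -1) (by norm_num)).2
    (integrableOn_Ioi_rpow_mul_exp_neg ha hr)) (fun t ht => ?_) measurableSet_Ioi
  exact (rpow_neg_one_sub_mul_exp_eq a r ht).symm

theorem integral_Ioi_rpow_mul_exp_neg_inv {a r : ℝ} (ha : 0 < a) (hr : 0 < r) :
    ∫ t in Ioi (0 : ℝ), t ^ (-a - 1) * Real.exp (-(r * t⁻¹)) = (1 / r) ^ a * Real.Gamma a := by
  rw [← Real.integral_rpow_mul_exp_neg_mul_Ioi ha hr,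
    ← integral_comp_rpow_Ioi (fun u : ℝ => u ^ (a - 1) * Real.exp (-(r * u))) (p := -1) (by norm_num)]
  exact setIntegral_congr_fun measurableSet_Ioi fun t ht => rpow_neg_one_sub_mul_exp_eq a r ht

theorem gaussian_scale_kernel_eq (α r : ℝ) {t : ℝ} (ht : 0 < t) :
    t ^ ((3 - α) / 2 - 1) * ((Real.pi / t) ^ (3 / 2 : ℝ) * Real.exp (-(r * t⁻¹))) =
      Real.pi ^ (3 / 2 : ℝ) * (t ^ (-(α / 2) - 1) * Real.exp (-(r * t⁻¹))) := by
  rw [Real.div_rpow Real.pi_pos.le ht.le,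
    show (3 - α) / 2 - 1 = (-(α / 2) - 1) + 3 / 2 by ring, Real.rpow_add ht]
  have : t ^ (3 / 2 : ℝ) ≠ 0 := by positivity
  field_simp

theorem sq_rpow_half {y : ℝ} (hy : 0 ≤ y) (a : ℝ) : (y ^ 2) ^ (a / 2) = y ^ a := by
  rw [← Real.rpow_natCast_mul hy]
  congr 1
  push_cast
  ring

theorem integral_rieszKernel_mul_eq {α : ℝ} (h0 : 0 < α) (h3 : α < 3) (φ : SchwartzMap E3 ℂ) :
    ((Real.pi ^ (3 / 2 : ℝ) * (4 ^ (α / 2) * Real.Gamma (α / 2)) : ℝ) : ℂ) *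
        ∫ x : E3, ((‖x‖ ^ (-α) : ℝ) : ℂ) * φ x =
      (Real.Gamma ((3 - α) / 2) : ℂ) *
        ∫ ξ : E3, ((‖ξ‖ ^ (α - 3) : ℝ) : ℂ) * schwartzFourier φ ξ := by
  obtain ⟨C, -, hC⟩ := φ.exists_norm_le_inv_sq
  obtain ⟨C', -, hC'⟩ := exists_norm_schwartzFourier_le φ
  rw [← integral_Ioi_integral_kernel_mul
      (k := fun t x => t ^ ((3 - α) / 2 - 1) *
        ((Real.pi / t) ^ (3 / 2 : ℝ) * Real.exp (-(‖x‖ ^ 2 / 4 * t⁻¹)))) (by fun_prop)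
      (fun t ht x => by positivity) ?_ ?_ φ.continuous
      (integrable_norm_rpow_mul φ.continuous hC (by linarith) (by linarith)),
    ← integral_Ioi_integral_kernel_mul
      (k := fun t x => t ^ ((3 - α) / 2 - 1) * Real.exp (-(t * ‖x‖ ^ 2))) (by fun_prop)
      (fun t ht x => by positivity) ?_ ?_ (continuous_schwartzFourier φ)
      (integrable_norm_rpow_mul (continuous_schwartzFourier φ) hC' (by linarith) (by linarith))]
  · refine setIntegral_congr_fun measurableSet_Ioi fun t ht => ?_
    have := integral_gaussian_mul_schwartzFourier φ (t := t) ht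
    simp only [Complex.ofReal_mul (t ^ ((3 - α) / 2 - 1)), mul_assoc, integral_const_mul]
    rw [this]
  · intro x hx
    have hx0 : 0 < ‖x‖ := norm_pos_iff.2 hx
    refine (integrableOn_Ioi_rpow_mul_exp_neg (a := (3 - α) / 2) (r := ‖x‖ ^ 2) (by linarith)
      (by positivity)).congr_fun (fun t _ => ?_) measurableSet_Ioi
    simp only [mul_comm t]
  · intro x hx
    have hx0 : 0 < ‖x‖ := norm_pos_iff.2 hx
    simp only [mul_comm _ (‖x‖ ^ 2)]
    rw [Real.integral_rpow_mul_exp_neg_mul_Ioi (by linarith) (by positivity), one_div,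
      Real.inv_rpow (by positivity), sq_rpow_half hx0.le, ← Real.rpow_neg hx0.le, neg_sub, mul_comm]
  · intro x hx
    have hx0 : 0 < ‖x‖ := norm_pos_iff.2 hx
    refine IntegrableOn.congr_fun ((integrableOn_Ioi_rpow_mul_exp_neg_inv (a := α / 2)
      (r := ‖x‖ ^ 2 / 4) (by linarith) (by positivity)).const_mul (Real.pi ^ (3 / 2 : ℝ)))
      (fun t ht => ?_) measurableSet_Ioi
    exact (gaussian_scale_kernel_eq α _ ht).symm
  · intro x hx
    have hx0 : 0 < ‖x‖ := norm_pos_iff.2 hx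
    rw [setIntegral_congr_fun measurableSet_Ioi
      (fun t ht => gaussian_scale_kernel_eq α (‖x‖ ^ 2 / 4) ht), integral_const_mul,
      integral_Ioi_rpow_mul_exp_neg_inv (by linarith) (by positivity), one_div_div,
      Real.div_rpow (by norm_num) (by positivity), sq_rpow_half hx0.le, Real.rpow_neg hx0.le]
    ring

/-! ### The spectral measures. -/

/-- The measure with density `κ |ζ|^(α - 3)`. -/
noncomputable def rieszSpectralMeasure (κ α : ℝ) : Measure E3 :=
  volume.withDensity fun ζ : E3 => ENNReal.ofReal (κ * ‖ζ‖ ^ (α - 3))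

theorem powWeighted_rieszSpectralMeasure {κ : ℝ} (hκ : 0 ≤ κ) (α γ : ℝ) :
    powWeighted (rieszSpectralMeasure κ α) γ = rieszSpectralMeasure κ (α + 2 * γ) := by
  rw [powWeighted, rieszSpectralMeasure, ← withDensity_mul _ (by fun_prop) (by fun_prop)]
  refine withDensity_congr_ae ?_
  filter_upwards [Measure.ae_ne (volume : Measure E3) 0] with ζ hζ
  rw [Pi.mul_apply, ← ENNReal.ofReal_mul (by positivity), mul_assoc,
    ← Real.rpow_add (norm_pos_iff.2 hζ)]
  ring_nf

theorem isTemperedMeasure_rieszSpectralMeasure {κ α : ℝ} (hκ : 0 ≤ κ) (h0 : 0 < α) (h3 : α < 3) :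
    IsTemperedMeasure (rieszSpectralMeasure κ α) := by
  refine ⟨2, by norm_num, ?_⟩
  rw [rieszSpectralMeasure, integrable_withDensity_iff_integrable_smul' (by fun_prop)
    (ae_of_all _ fun _ => ENNReal.ofReal_lt_top)]
  refine ((integrable_norm_rpow_mul_inv (a := α - 3) (by linarith) (by linarith)).const_mul
    κ).congr (ae_of_all _ fun x => ?_)
  simp only
  rw [ENNReal.toReal_ofReal (by positivity), smul_eq_mul, mul_assoc]

/-- The factor `κ` stays free because weighting changes `α` but keeps the `κ` that was normalized
for `β`. -/
theorem exists_isSpectralMeasure_riesz {α : ℝ} (h0 : 0 < α) (h3 : α < 3) :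
    ∃ k : ℝ, 0 < k ∧ ∀ κ : ℝ, 0 < κ →
      IsSpectralMeasure (fun x => κ * k * rieszKernel α x) (rieszSpectralMeasure κ α) := by
  have hΓ : 0 < Real.Gamma (α / 2) := Real.Gamma_pos_of_pos (by linarith)
  have hΓ' : 0 < Real.Gamma ((3 - α) / 2) := Real.Gamma_pos_of_pos (by linarith)
  refine ⟨Real.pi ^ (3 / 2 : ℝ) * (4 ^ (α / 2) * Real.Gamma (α / 2)) /
    Real.Gamma ((3 - α) / 2), by positivity, fun κ hκ => ?_⟩
  set b := Real.pi ^ (3 / 2 : ℝ) * (4 ^ (α / 2) * Real.Gamma (α / 2)) with hb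
  have hb0 : 0 < b := by positivity
  refine ⟨fun x => ?_, ?_, fun φ => ?_, isTemperedMeasure_rieszSpectralMeasure hκ.le h0 h3,
    fun φ => ?_⟩
  · unfold rieszKernel
    positivity
  · exact (locallyIntegrable_norm_rpow (a := -α) (by linarith)).smul
      (κ * (b / Real.Gamma ((3 - α) / 2)))
  · obtain ⟨C, -, hC⟩ := φ.exists_norm_le_inv_sq
    refine ((integrable_norm_rpow_mul φ.continuous hC (a := -α) (by linarith)
      (by linarith)).const_mul ((κ * (b / Real.Gamma ((3 - α) / 2)) : ℝ) : ℂ)).congr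
      (ae_of_all _ fun x => ?_)
    simp only [rieszKernel]
    rw [Complex.ofReal_mul (κ * (b / Real.Gamma ((3 - α) / 2))), mul_assoc]
  · have h := integral_rieszKernel_mul_eq h0 h3 φ
    rw [← hb] at h
    rw [rieszSpectralMeasure, integral_withDensity_eq_integral_toReal_smul (by fun_prop)
      (ae_of_all _ fun _ => ENNReal.ofReal_lt_top)]
    have e1 : ∀ x : E3, (ENNReal.ofReal (κ * ‖x‖ ^ (α - 3))).toReal • schwartzFourier φ x =
        (κ : ℂ) * (((‖x‖ ^ (α - 3) : ℝ) : ℂ) * schwartzFourier φ x) := fun x => by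
      rw [ENNReal.toReal_ofReal (by positivity), Complex.real_smul, Complex.ofReal_mul, mul_assoc]
    have e2 : ∀ x : E3, ((κ * (b / Real.Gamma ((3 - α) / 2)) * rieszKernel α x : ℝ) : ℂ) * φ x =
        ((κ * (b / Real.Gamma ((3 - α) / 2)) : ℝ) : ℂ) * (((‖x‖ ^ (-α) : ℝ) : ℂ) * φ x) :=
      fun x => by rw [Complex.ofReal_mul, rieszKernel, mul_assoc]
    simp only [e1, e2, integral_const_mul]
    have hne : (Real.Gamma ((3 - α) / 2) : ℂ) ≠ 0 := by exact_mod_cast hΓ'.ne'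
    rw [Complex.ofReal_mul, Complex.ofReal_div, mul_assoc, div_mul_eq_mul_div, h,
      mul_div_cancel_left₀ _ hne]

theorem lintegral_rieszSpectralMeasure_lt_top {κ α γ : ℝ} (hκ : 0 ≤ κ) (h0 : 0 < α)
    (h : α + 2 * γ < 2) :
    ∫⁻ ζ : E3, ENNReal.ofReal (1 / (1 + ‖ζ‖ ^ (2 - 2 * γ))) ∂(rieszSpectralMeasure κ α) < ⊤ := by
  have hF : Integrable (fun ζ : E3 => ‖ζ‖ ^ (α - 3) * (1 / (1 + ‖ζ‖ ^ (2 - 2 * γ)))) := by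
    refine integrable_radial_of_le_rpow
      (F := fun y => y ^ (α - 3) * (1 / (1 + y ^ (2 - 2 * γ)))) (a := α - 3)
      (b := α - 3 - (2 - 2 * γ)) (by fun_prop) (by linarith) (by linarith) ?_ ?_
    · intro y hy _
      rw [abs_of_nonneg (by positivity)]
      refine mul_le_of_le_one_right (by positivity) ?_
      rw [div_le_one (by positivity)]
      exact le_add_of_nonneg_right (by positivity)
    · intro y hy
      have hy0 : 0 < y := one_pos.trans hy
      rw [abs_of_nonneg (by positivity), Real.rpow_sub hy0 (α - 3), div_eq_mul_one_div (y ^ (α - 3))]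
      gcongr
      exact le_add_of_nonneg_left zero_le_one
  rw [rieszSpectralMeasure, lintegral_withDensity_eq_lintegral_mul _ (by fun_prop) (by fun_prop)]
  refine lt_of_eq_of_lt (lintegral_congr fun ζ => ?_) (hF.const_mul κ).lintegral_lt_top
  rw [Pi.mul_apply, ← ENNReal.ofReal_mul (by positivity), mul_assoc]

theorem exists_spectralMeasure_rieszKernel {β : ℝ} (hβ0 : 0 < β) (hβ2 : β < 2) :
    ∃ μ : Measure E3, IsSpectralMeasure (rieszKernel β) μ ∧
      ∀ γ : ℝ, 0 < γ → γ < (2 - β) / 2 → SpectralCondition μ γ := by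
  obtain ⟨k, hk, hspec⟩ := exists_isSpectralMeasure_riesz hβ0 (by linarith)
  -- The choice `κ = k⁻¹` makes the transform exactly `rieszKernel β`, with no constant.
  refine ⟨rieszSpectralMeasure k⁻¹ β, ?_, fun γ hγ0 hγ => ⟨hγ0, by linarith, ?_,
    lintegral_rieszSpectralMeasure_lt_top (by positivity) hβ0 (by linarith)⟩⟩
  · simpa only [inv_mul_cancel₀ hk.ne', one_mul] using hspec k⁻¹ (by positivity)
  · rw [powWeighted_rieszSpectralMeasure (by positivity)]
    obtain ⟨k', -, hspec'⟩ := exists_isSpectralMeasure_riesz (α := β + 2 * γ) (by linarith)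
      (by linarith)
    exact ⟨_, hspec' k⁻¹ (by positivity)⟩

theorem proposition5p2 (β : ℝ) (hβ0 : 0 < β) (hβ2 : β < 2) (T : ℝ) (hT : 0 < T) :
    (∃ μ : Measure E3, IsSpectralMeasure (rieszKernel β) μ ∧
      ∀ γ : ℝ, 0 < γ → γ < (2 - β) / 2 → SpectralCondition μ γ) ∧
    BallBound (rieszKernel β) T (2 - β) ∧
    (0 < min (2 - β) 1 ∧ min (2 - β) 1 ≤ 1 ∧ BallBound (rieszKernel β) T (min (2 - β) 1)) ∧
    (∀ ρ₁ : ℝ, 0 < ρ₁ → ρ₁ < min (2 - β) 1 → TimeCondition1 (rieszKernel β) T ρ₁) ∧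
    (∀ ρ₂ : ℝ, 0 < ρ₂ → ρ₂ < 2 - β → TimeCondition2 (rieszKernel β) T ρ₂) := by
  have hball := ballBound_rieszKernel hβ0 hβ2 T
  refine ⟨exists_spectralMeasure_rieszKernel hβ0 hβ2, hball,
    ⟨lt_min (by linarith) one_pos, min_le_right _ _, hball.mono_exponent (min_le_left _ _)⟩,
    fun ρ h0 h => ?_, fun ρ h0 h => timeCondition2_rieszKernel hβ0 hT h0 h⟩
  exact timeCondition1_rieszKernel hβ0 hT h0 (h.trans_le (min_le_left _ _))
    (h.le.trans (min_le_right _ _))
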